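/- Consider the Gaussian linear bandit with $K$ arms: arm $i$ has feature vector $x_i\in\mathbb R^d$, the parameter is drawn from the prior $\theta\sim\mathcal N(\mu_0,\Sigma_0)$ with $\Sigma_0$ positive definite, and, given $\theta$, the rewards are independent, each reward of arm $i$ having law $\mathcal N(\theta^\top x_i,\sigma^2)$, where $\sigma>0$. Assume that the $x_i$ are pairwise distinct and span $\mathbb R^d$. Fix weights $\omega$ with $\omega_i>0$ for all $i$ and $\sum_i\omega_i=1$. With budget $n\ge 1$, the algorithm collects $n_i=\lfloor\omega_i n\rfloor$ rewards of each arm $i$ and then, $H_n$ being the observed history, returns an arm $J_n\in\arg\max_i\mathbb E[\theta^\top x_i\mid H_n]$ (ties broken arbitrarily). Let $i_*(\theta)\in\arg\max_i\theta^\top x_i$ (almost surely unique), let $\mathcal P_n=\mathbb E\big[\mathbb P(J_n\ne i_*(\theta)\mid\theta)\big]$ be the expected probability of error, and write $\|v\|_A^2=v^\top A v$ and $\hat\mu_n=\mathbb E[\theta\mid H_n]$. (1) For every $n\ge1$ such that all $\omega_i n$ are integers, $$\mathcal P_n\le\sum_{i\ne j}\frac{1}{\sqrt{1+\dfrac{n\,c_{ij}(\omega)}{\|x_i-x_j\|^2_{\tilde\Sigma_n}}}}\exp\!\left(-\frac{(\mu_0^\top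 x_i-\mu_0^\top x_j)^2}{2\|x_i-x_j\|^2_{\Sigma_0}}\right),$$ where the sum is over ordered pairs, $\tilde\Sigma_n=\big(\tfrac1n\Sigma_0^{-1}+\sigma^{-2}\sum_i\omega_i x_ix_i^\top\big)^{-1}$ and $c_{ij}(\omega)=\|x_i-x_j\|^2_{\mathrm{Cov}(\hat\mu_n)}$. Moreover the covariance matrix of $\hat\mu_n$ is $$\mathrm{Cov}(\hat\mu_n)=\frac1{\sigma^4}\hat\Sigma_n\Big(\sum_i\omega_i n\big(\sigma^2+\omega_i n\,x_i^\top\Sigma_0x_i\big)x_ix_i^\top+\sum_{i\ne j}\omega_i\omega_jn^2\,(x_i^\top\Sigma_0x_j)\,x_ix_j^\top\Big)\hat\Sigma_n,$$ with $\hat\Sigma_n=\big(\Sigma_0^{-1}+\sigma^{-2}\sum_i\omega_i n\,x_ix_i^\top\big)^{-1}$. (2) $\mathcal P_n=O(1/\sqrt n)$: there is a constant $C$, depending only on $\mu_0,\Sigma_0,\sigma,(x_i)_i,\omega$, such that $\mathcal P_n\le C/\sqrt n$ for all $n\ge1$ (whether or not the $\omega_i n$ are integers). -/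

import Mathlib

open MeasureTheory ProbabilityTheory
open scoped Matrix

noncomputable section

namespace LinBandit

/-- Number of samples collected from arm `i` with budget `n`: `⌊ω i * n⌋`. -/
def pulls {K : ℕ} (ω : Fin K → ℝ) (n : ℕ) (i : Fin K) : ℕ := ⌊ω i * n⌋₊

/-- Observed rewards when arm `i` is pulled `N i` times: `y ⟨i, k⟩` is the reward of the `k`-th pull
of arm `i`.  (The schedule of arms is deterministic, so this is the whole history.) -/
abbrev History {K : ℕ} (N : Fin K → ℕ) : Type := ((i : Fin K) × Fin (N i)) → ℝ

/-- Mean reward `r(i; θ) = θᵀ xᵢ` of arm `i`. -/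
def meanReward {d K : ℕ} (x : Fin K → EuclideanSpace ℝ (Fin d)) (θ : EuclideanSpace ℝ (Fin d))
    (i : Fin K) : ℝ :=
  inner ℝ θ (x i)

/-- Law of the history given `θ`: the rewards are independent, and every reward of arm `i` has
law `N(θᵀ xᵢ, σ²)`. -/
def historyLaw {d K : ℕ} (x : Fin K → EuclideanSpace ℝ (Fin d)) (σ : ℝ) (N : Fin K → ℕ)
    (θ : EuclideanSpace ℝ (Fin d)) : Measure (History N) :=
  Measure.pi fun p => gaussianReal (meanReward x θ p.1) (σ ^ 2).toNNReal

instance {d K : ℕ} (x : Fin K → EuclideanSpace ℝ (Fin d)) (σ : ℝ) (N : Fin K → ℕ)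
    (θ : EuclideanSpace ℝ (Fin d)) : IsProbabilityMeasure (historyLaw x σ N θ) := by
  unfold historyLaw; infer_instance

theorem measurable_historyLaw {d K : ℕ} (x : Fin K → EuclideanSpace ℝ (Fin d)) (σ : ℝ)
    (N : Fin K → ℕ) : Measurable (historyLaw x σ N) := by
  have hg : Measurable fun q : EuclideanSpace ℝ (Fin d) × History N =>
      (fun p => q.2 p + meanReward x q.1 p.1 : History N) := by
    unfold meanReward; fun_prop
  have h : historyLaw x σ N = fun θ =>
      ((Measure.pi fun _ : ((i : Fin K) × Fin (N i)) => gaussianReal 0 (σ ^ 2).toNNReal).map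
        (Prod.mk θ)).map
          (fun q => (fun p => q.2 p + meanReward x q.1 p.1 : History N)) := by
    funext θ
    rw [Measure.map_map hg measurable_prodMk_left]
    unfold historyLaw
    symm
    have := Measure.pi_map_pi
      (μ := fun _ : ((i : Fin K) × Fin (N i)) => gaussianReal 0 (σ ^ 2).toNNReal)
      (f := fun p (t : ℝ) => t + meanReward x θ p.1)
      (fun p => (by fun_prop))
    simp only [gaussianReal_map_add_const, zero_add] at this
    exact this
  rw [h]
  exact (Measure.measurable_map _ hg).comp Measurable.map_prodMk_left

/-- The Markov kernel `θ ↦` law of the history given `θ`. -/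
def historyKernel {d K : ℕ} (x : Fin K → EuclideanSpace ℝ (Fin d)) (σ : ℝ) (N : Fin K → ℕ) :
    Kernel (EuclideanSpace ℝ (Fin d)) (History N) where
  toFun := historyLaw x σ N
  measurable' := measurable_historyLaw x σ N

/-- Joint law of `(θ, history)` in the Gaussian linear bandit with prior `θ ∼ N(μ₀, S₀)`. -/
def jointLaw {d K : ℕ} (μ₀ : EuclideanSpace ℝ (Fin d)) (S₀ : Matrix (Fin d) (Fin d) ℝ)
    (x : Fin K → EuclideanSpace ℝ (Fin d)) (σ : ℝ) (N : Fin K → ℕ) :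
    Measure (EuclideanSpace ℝ (Fin d) × History N) :=
  multivariateGaussian μ₀ S₀ ⊗ₘ historyKernel x σ N

/-- The σ-algebra generated by the history. -/
abbrev historySigma (d : ℕ) {K : ℕ} (N : Fin K → ℕ) :
    MeasurableSpace (EuclideanSpace ℝ (Fin d) × History N) :=
  MeasurableSpace.comap Prod.snd inferInstance

/-- Mean posterior reward `E[r(i; θ) | H]` of arm `i`. -/
def posteriorReward {d K : ℕ} (μ₀ : EuclideanSpace ℝ (Fin d)) (S₀ : Matrix (Fin d) (Fin d) ℝ)
    (x : Fin K → EuclideanSpace ℝ (Fin d)) (σ : ℝ) (N : Fin K → ℕ) (i : Fin K) :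
    EuclideanSpace ℝ (Fin d) × History N → ℝ :=
  (jointLaw μ₀ S₀ x σ N)[fun p => meanReward x p.1 i | historySigma d N]

/-- Posterior mean `E[θ | H]`. -/
def posteriorMean {d K : ℕ} (μ₀ : EuclideanSpace ℝ (Fin d)) (S₀ : Matrix (Fin d) (Fin d) ℝ)
    (x : Fin K → EuclideanSpace ℝ (Fin d)) (σ : ℝ) (N : Fin K → ℕ) :
    EuclideanSpace ℝ (Fin d) × History N → EuclideanSpace ℝ (Fin d) :=
  (jointLaw μ₀ S₀ x σ N)[fun p => p.1 | historySigma d N]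

/-- Covariance matrix of the posterior mean (as a random vector, a function of the history). -/
def covPosteriorMean {d K : ℕ} (μ₀ : EuclideanSpace ℝ (Fin d)) (S₀ : Matrix (Fin d) (Fin d) ℝ)
    (x : Fin K → EuclideanSpace ℝ (Fin d)) (σ : ℝ) (N : Fin K → ℕ) : Matrix (Fin d) (Fin d) ℝ :=
  Matrix.of fun a b =>
    cov[fun p => posteriorMean μ₀ S₀ x σ N p a, fun p => posteriorMean μ₀ S₀ x σ N p b;
      jointLaw μ₀ S₀ x σ N]

/-- `J` is a (measurable) decision rule which selects an arm of maximal mean posterior reward;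
ties are broken arbitrarily. -/
structure IsDecisionRule {d K : ℕ} (μ₀ : EuclideanSpace ℝ (Fin d)) (S₀ : Matrix (Fin d) (Fin d) ℝ)
    (x : Fin K → EuclideanSpace ℝ (Fin d)) (σ : ℝ) (N : Fin K → ℕ) (J : History N → Fin K) :
    Prop where
  measurable : Measurable J
  argmax : ∀ᵐ p ∂jointLaw μ₀ S₀ x σ N, ∀ i,
    posteriorReward μ₀ S₀ x σ N i p ≤ posteriorReward μ₀ S₀ x σ N (J p.2) p

/-- `best` selects an optimal arm `i_*(θ)` for every `θ`.  (The optimal arm is almost surely unique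
under a nondegenerate Gaussian prior with distinct features.) -/
structure IsBestArm {d K : ℕ} (x : Fin K → EuclideanSpace ℝ (Fin d))
    (best : EuclideanSpace ℝ (Fin d) → Fin K) : Prop where
  measurable : Measurable best
  argmax : ∀ θ i, meanReward x θ i ≤ meanReward x θ (best θ)

/-- Expected probability of error `E[P(J ≠ i_*(θ) | θ)]`. -/
def expectedPoE {d K : ℕ} (μ₀ : EuclideanSpace ℝ (Fin d)) (S₀ : Matrix (Fin d) (Fin d) ℝ)
    (x : Fin K → EuclideanSpace ℝ (Fin d)) (σ : ℝ) (N : Fin K → ℕ)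
    (best : EuclideanSpace ℝ (Fin d) → Fin K) (J : History N → Fin K) : ℝ :=
  ∫ θ, (historyKernel x σ N θ).real {y | J y ≠ best θ} ∂multivariateGaussian μ₀ S₀

/-- `‖v‖²_A = vᵀ A v`. -/
def sqNorm {d : ℕ} (A : Matrix (Fin d) (Fin d) ℝ) (v : EuclideanSpace ℝ (Fin d)) : ℝ :=
  v.ofLp ⬝ᵥ A *ᵥ v.ofLp

/-- The matrix `u vᵀ`. -/
def outer {d : ℕ} (u v : EuclideanSpace ℝ (Fin d)) : Matrix (Fin d) (Fin d) ℝ :=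
  Matrix.vecMulVec u.ofLp v.ofLp

/-- `Σ̂ₙ = (S₀⁻¹ + σ⁻² ∑ᵢ ωᵢ n xᵢ xᵢᵀ)⁻¹`. -/
def sigmaHat {d K : ℕ} (S₀ : Matrix (Fin d) (Fin d) ℝ) (x : Fin K → EuclideanSpace ℝ (Fin d))
    (σ : ℝ) (ω : Fin K → ℝ) (n : ℕ) : Matrix (Fin d) (Fin d) ℝ :=
  (S₀⁻¹ + (1 / σ ^ 2) • ∑ i, (ω i * n) • outer (x i) (x i))⁻¹

/-- `Σ̃ₙ = (n⁻¹ S₀⁻¹ + σ⁻² ∑ᵢ ωᵢ xᵢ xᵢᵀ)⁻¹`. -/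
def sigmaTilde {d K : ℕ} (S₀ : Matrix (Fin d) (Fin d) ℝ) (x : Fin K → EuclideanSpace ℝ (Fin d))
    (σ : ℝ) (ω : Fin K → ℝ) (n : ℕ) : Matrix (Fin d) (Fin d) ℝ :=
  ((1 / (n : ℝ)) • S₀⁻¹ + (1 / σ ^ 2) • ∑ i, ω i • outer (x i) (x i))⁻¹

/-- Explicit covariance of the posterior mean,
`σ⁻⁴ Σ̂ₙ (∑ᵢ ωᵢ n (σ² + ωᵢ n xᵢᵀ S₀ xᵢ) xᵢ xᵢᵀ + ∑_{i ≠ j} ωᵢ ωⱼ n² (xᵢᵀ S₀ xⱼ) xᵢ xⱼᵀ) Σ̂ₙ`. -/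
def covExplicit {d K : ℕ} (S₀ : Matrix (Fin d) (Fin d) ℝ) (x : Fin K → EuclideanSpace ℝ (Fin d))
    (σ : ℝ) (ω : Fin K → ℝ) (n : ℕ) : Matrix (Fin d) (Fin d) ℝ :=
  (1 / σ ^ 4) • (sigmaHat S₀ x σ ω n *
    (∑ i, (ω i * n * (σ ^ 2 + ω i * n * sqNorm S₀ (x i))) • outer (x i) (x i) +
      ∑ i, ∑ j ∈ Finset.univ.erase i,
        (ω i * ω j * (n : ℝ) ^ 2 * ((x i).ofLp ⬝ᵥ S₀ *ᵥ (x j).ofLp)) • outer (x i) (x j)) *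
    sigmaHat S₀ x σ ω n)

end LinBandit

end

/-!
The rewards are linear forms of `θ` plus independent Gaussian noise, so `(θ, H)` is jointly Gaussian
(`isGaussian_jointLaw`). The linear regression of `θ` on the rewards (`gain`, `estimator`) leaves a
residual that is uncorrelated with the rewards, hence independent of the whole history
(`indepFun_residual_history`). It follows that the regression is the posterior mean
(`posteriorMean_ae_eq`), that the residual has covariance
`Σ̂ = (S₀⁻¹ + σ⁻² ∑ᵢ Nᵢ xᵢ xᵢᵀ)⁻¹`, and that the posterior mean has covariance `S₀ - Σ̂`
(`covPosteriorMean_eq`), which is the explicit formula by matrix algebra (`covExplicit_eq_sub`).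

An error means that, for some ordered pair `i ≠ j` with `Δ = xᵢ - xⱼ`, the gap `Δᵀ θ` is nonnegative
although its posterior mean `M` is nonpositive. Here `M ∼ N(Δᵀ μ₀, c)` with
`c = Δᵀ (S₀ - Σ̂) Δ`, and `Δᵀ θ = M + Z` with `Z ∼ N(0, s)`, `s = Δᵀ Σ̂ Δ`, independent of `M`.
Chernoff's bound for `Z` gives the conditional bound `exp (-M² / 2s)`, whose expectation is the
Gaussian integral `(1 + c / s)^(-1/2) exp (-(Δᵀ μ₀)² / (2 (c + s)))`, with `c + s = Δᵀ S₀ Δ`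
(`measureReal_sign_change_le`, `expectedPoE_le`). This is the bound of the first part, because
`Σ̃ₙ = n Σ̂ₙ`.

For the rate, `1 + c / s = Δᵀ S₀ Δ / s`, so that each pair contributes `O(√s)`, and `s = O(1 / n)`
since the two arms `i` and `j` alone are each pulled a number of times proportional to `n`
(`sqNorm_posteriorCov_le`, `pair_bound_le`).
-/

namespace LinBandit

open scoped NNReal

variable {d K : ℕ}

/-! ### The joint law of the parameter and the rewards -/

/-- The reward of the pull `p`, as a continuous linear form on histories. -/
noncomputable def rewardCLM (N : Fin K → ℕ) (p : (i : Fin K) × Fin (N i)) : History N →L[ℝ] ℝ :=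
  ContinuousLinearMap.proj p

theorem historyLaw_eq_map_noise (x : Fin K → EuclideanSpace ℝ (Fin d)) (σ : ℝ) (N : Fin K → ℕ)
    (θ : EuclideanSpace ℝ (Fin d)) :
    historyLaw x σ N θ =
      (historyLaw x σ N 0).map (fun ε p => ε p + meanReward x θ p.1) := by
  have := Measure.pi_map_pi
    (μ := fun _ : ((i : Fin K) × Fin (N i)) => gaussianReal 0 (σ ^ 2).toNNReal)
    (f := fun p (t : ℝ) => t + meanReward x θ p.1) (fun p => (by fun_prop))
  simp only [gaussianReal_map_add_const, zero_add] at this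
  simp only [historyLaw, meanReward, inner_zero_left]
  exact this.symm

instance isMarkovKernel_historyKernel (x : Fin K → EuclideanSpace ℝ (Fin d)) (σ : ℝ)
    (N : Fin K → ℕ) : IsMarkovKernel (historyKernel x σ N) :=
  ⟨fun θ => inferInstanceAs (IsProbabilityMeasure (historyLaw x σ N θ))⟩

/-- The joint law is that of `(θ, (⟪θ, x_p⟫ + ε_p)_p)` where the noise `ε` is independent of `θ`;
the law of the noise is the law of the history for the parameter `0`. -/
theorem jointLaw_eq_map_prod (μ₀ : EuclideanSpace ℝ (Fin d)) (S₀ : Matrix (Fin d) (Fin d) ℝ)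
    (x : Fin K → EuclideanSpace ℝ (Fin d)) (σ : ℝ) (N : Fin K → ℕ) :
    jointLaw μ₀ S₀ x σ N = ((multivariateGaussian μ₀ S₀).prod (historyLaw x σ N 0)).map
      (fun q => (q.1, fun p => q.2 p + meanReward x q.1 p.1)) := by
  have hm : Measurable fun q : EuclideanSpace ℝ (Fin d) × History N =>
      (q.1, (fun p => q.2 p + meanReward x q.1 p.1 : History N)) := by
    unfold meanReward; fun_prop
  ext s hs
  rw [jointLaw, Measure.compProd_apply hs, Measure.map_apply hm hs,
    Measure.prod_apply (hm hs)]
  refine lintegral_congr fun θ => ?_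
  change historyLaw x σ N θ _ = _
  rw [historyLaw_eq_map_noise, Measure.map_apply (by fun_prop) (measurable_prodMk_left hs)]
  rfl

theorem iIndepFun_historyLaw (x : Fin K → EuclideanSpace ℝ (Fin d)) (σ : ℝ) (N : Fin K → ℕ)
    (θ : EuclideanSpace ℝ (Fin d)) :
    iIndepFun (fun (p : (i : Fin K) × Fin (N i)) (y : History N) => y p)
      (historyLaw x σ N θ) :=
  iIndepFun_pi (μ := fun p : ((i : Fin K) × Fin (N i)) =>
    gaussianReal (meanReward x θ p.1) (σ ^ 2).toNNReal) (X := fun _ (t : ℝ) => t)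
    (fun _ => aemeasurable_id)

theorem measurePreserving_reward (x : Fin K → EuclideanSpace ℝ (Fin d)) (σ : ℝ) (N : Fin K → ℕ)
    (θ : EuclideanSpace ℝ (Fin d)) (p : (i : Fin K) × Fin (N i)) :
    MeasurePreserving (fun y : History N => y p) (historyLaw x σ N θ)
      (gaussianReal (meanReward x θ p.1) (σ ^ 2).toNNReal) :=
  measurePreserving_eval (fun p : ((i : Fin K) × Fin (N i)) =>
    gaussianReal (meanReward x θ p.1) (σ ^ 2).toNNReal) p

instance isGaussian_historyLaw (x : Fin K → EuclideanSpace ℝ (Fin d)) (σ : ℝ) (N : Fin K → ℕ)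
    (θ : EuclideanSpace ℝ (Fin d)) : IsGaussian (historyLaw x σ N θ) := by
  have h := (iIndepFun_historyLaw x σ N θ).hasGaussianLaw fun p =>
    ⟨by rw [(measurePreserving_reward x σ N θ p).map_eq]; infer_instance⟩
  simpa using h.isGaussian_map

instance isGaussian_jointLaw (μ₀ : EuclideanSpace ℝ (Fin d)) (S₀ : Matrix (Fin d) (Fin d) ℝ)
    (x : Fin K → EuclideanSpace ℝ (Fin d)) (σ : ℝ) (N : Fin K → ℕ) :
    IsGaussian (jointLaw μ₀ S₀ x σ N) := by
  rw [jointLaw_eq_map_prod]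
  let A : (EuclideanSpace ℝ (Fin d) × History N) →L[ℝ] EuclideanSpace ℝ (Fin d) :=
    ContinuousLinearMap.fst ℝ _ _
  let L : (EuclideanSpace ℝ (Fin d) × History N) →L[ℝ] (EuclideanSpace ℝ (Fin d) × History N) :=
    A.prod (ContinuousLinearMap.pi fun p =>
      (rewardCLM N p) ∘L (ContinuousLinearMap.snd ℝ _ _) + (innerSL ℝ (x p.1)) ∘L A)
  have hL : (fun q : EuclideanSpace ℝ (Fin d) × History N =>
      (q.1, (fun p => q.2 p + meanReward x q.1 p.1 : History N))) = L := by
    funext q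
    refine Prod.ext rfl ?_
    funext p
    simp [L, A, rewardCLM, meanReward, real_inner_comm]
  rw [hL]
  infer_instance

section Moments

variable (μ₀ : EuclideanSpace ℝ (Fin d)) (S₀ : Matrix (Fin d) (Fin d) ℝ)
  (x : Fin K → EuclideanSpace ℝ (Fin d)) (σ : ℝ) (N : Fin K → ℕ)

theorem fst_jointLaw : (jointLaw μ₀ S₀ x σ N).map Prod.fst = multivariateGaussian μ₀ S₀ :=
  Measure.fst_compProd _ _

theorem memLp_param (u : EuclideanSpace ℝ (Fin d)) :
    MemLp (fun p : EuclideanSpace ℝ (Fin d) × History N => inner ℝ u p.1) 2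
      (jointLaw μ₀ S₀ x σ N) := by
  have h : MemLp (innerSL ℝ u) 2 (multivariateGaussian μ₀ S₀) :=
    IsGaussian.memLp_dual _ _ 2 (by simp)
  exact h.comp_measurePreserving ⟨measurable_fst, fst_jointLaw μ₀ S₀ x σ N⟩

theorem memLp_reward (p : (i : Fin K) × Fin (N i)) :
    MemLp (fun q : EuclideanSpace ℝ (Fin d) × History N => q.2 p) 2 (jointLaw μ₀ S₀ x σ N) := by
  let L : (EuclideanSpace ℝ (Fin d) × History N) →L[ℝ] ℝ :=
    (rewardCLM N p).comp (ContinuousLinearMap.snd ℝ _ _)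
  exact IsGaussian.memLp_dual (jointLaw μ₀ S₀ x σ N) L 2 (by simp)

theorem integral_param (u : EuclideanSpace ℝ (Fin d)) :
    ∫ p, inner ℝ u p.1 ∂(jointLaw μ₀ S₀ x σ N) = inner ℝ u μ₀ := by
  have h := integral_map (μ := jointLaw μ₀ S₀ x σ N) (φ := Prod.fst) (by fun_prop)
    (f := fun θ => inner ℝ u θ) (by fun_prop)
  rw [← h, fst_jointLaw, integral_inner (f := fun θ => θ) IsGaussian.integrable_id,
    integral_id_multivariateGaussian]

variable {S₀} in
theorem cov_param_param (hS₀ : S₀.PosDef) (u v : EuclideanSpace ℝ (Fin d)) :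
    cov[fun p => inner ℝ u p.1, fun p => inner ℝ v p.1; jointLaw μ₀ S₀ x σ N] =
      u.ofLp ⬝ᵥ S₀ *ᵥ v.ofLp := by
  have h := covariance_map_fun (μ := jointLaw μ₀ S₀ x σ N) (Z := Prod.fst)
    (X := fun θ => inner ℝ u θ) (Y := fun θ => inner ℝ v θ) (by fun_prop) (by fun_prop)
    (by fun_prop)
  rw [← h, fst_jointLaw, ← covarianceBilin_apply_eq_cov IsGaussian.memLp_two_id,
    covarianceBilin_multivariateGaussian hS₀.posSemidef]

/-- The noise `y p - ⟪θ, x_p⟫` of the reward `p`. -/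
noncomputable def noise (p : (i : Fin K) × Fin (N i)) (q : EuclideanSpace ℝ (Fin d) × History N) : ℝ :=
  q.2 p - inner ℝ (x p.1) q.1

theorem measurable_noise (p : (i : Fin K) × Fin (N i)) : Measurable (noise x N p) := by
  unfold noise; fun_prop

theorem memLp_noise (p : (i : Fin K) × Fin (N i)) :
    MemLp (noise x N p) 2 (jointLaw μ₀ S₀ x σ N) :=
  (memLp_reward μ₀ S₀ x σ N p).sub (memLp_param μ₀ S₀ x σ N (x p.1))

theorem integral_noise (p : (i : Fin K) × Fin (N i)) :
    ∫ q, noise x N p q ∂(jointLaw μ₀ S₀ x σ N) = 0 := by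
  rw [jointLaw_eq_map_prod, integral_map (by unfold meanReward; fun_prop)
    (measurable_noise x N p).aestronglyMeasurable]
  simp only [noise, meanReward, real_inner_comm (x _), add_sub_cancel_right]
  have hp := measurePreserving_reward x σ N 0 p
  rw [integral_fun_snd (μ := multivariateGaussian μ₀ S₀) (fun y : History N => y p),
    ← integral_map (f := fun t : ℝ => t) hp.aemeasurable (by fun_prop), hp.map_eq,
    integral_id_gaussianReal]
  simp [meanReward]

theorem cov_param_noise (u : EuclideanSpace ℝ (Fin d)) (p : (i : Fin K) × Fin (N i)) :
    cov[fun q => inner ℝ u q.1, noise x N p; jointLaw μ₀ S₀ x σ N] = 0 := by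
  rw [jointLaw_eq_map_prod, covariance_map_fun]
  · simp only [noise, meanReward, real_inner_comm (x p.1), add_sub_cancel_right]
    exact covariance_fst_snd_prod (X := fun θ => inner ℝ u θ) (Y := fun y : History N => y p)
      (IsGaussian.memLp_dual _ (innerSL ℝ u) 2 (by simp))
      (IsGaussian.memLp_dual _ (rewardCLM N p) 2 (by simp))
  · fun_prop
  · exact (measurable_noise x N _).aestronglyMeasurable
  · unfold meanReward; fun_prop

theorem cov_noise_noise (p p' : (i : Fin K) × Fin (N i)) :
    cov[noise x N p, noise x N p'; jointLaw μ₀ S₀ x σ N] = if p = p' then σ ^ 2 else 0 := by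
  rw [jointLaw_eq_map_prod, covariance_map_fun]
  · simp only [noise, meanReward, real_inner_comm (x _), add_sub_cancel_right]
    have h := covariance_map_fun (μ := (multivariateGaussian μ₀ S₀).prod (historyLaw x σ N 0))
      (Z := Prod.snd) (X := fun y : History N => y p) (Y := fun y : History N => y p')
      (Measurable.aestronglyMeasurable (by fun_prop))
      (Measurable.aestronglyMeasurable (by fun_prop)) (by fun_prop)
    rw [← h, Measure.map_snd_prod]
    simp only [measure_univ, one_smul]
    split_ifs with hp
    · subst hp
      have hp := measurePreserving_reward x σ N 0 p
      rw [covariance_self hp.aemeasurable, hp.variance_fun_comp (f := fun t => t) (by fun_prop),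
        variance_fun_id_gaussianReal, Real.coe_toNNReal _ (sq_nonneg σ)]
    · exact ((iIndepFun_historyLaw x σ N 0).indepFun hp).covariance_eq_zero
        (IsGaussian.memLp_dual _ (rewardCLM N p) 2 (by simp))
        (IsGaussian.memLp_dual _ (rewardCLM N p') 2 (by simp))
  · exact (measurable_noise x N _).aestronglyMeasurable
  · exact (measurable_noise x N _).aestronglyMeasurable
  · unfold meanReward; fun_prop

/-- Every reward is the linear form `⟪x_p, θ⟫` of the parameter plus a centred noise. -/
theorem reward_eq (p : (i : Fin K) × Fin (N i)) :
    (fun q : EuclideanSpace ℝ (Fin d) × History N => q.2 p) =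
      (fun q => inner ℝ (x p.1) q.1) + noise x N p := by
  funext q; simp [noise]

theorem integral_reward (p : (i : Fin K) × Fin (N i)) :
    ∫ q, q.2 p ∂(jointLaw μ₀ S₀ x σ N) = inner ℝ (x p.1) μ₀ := by
  rw [reward_eq x N p, integral_add' ((memLp_param ..).integrable one_le_two)
    ((memLp_noise ..).integrable one_le_two), integral_param, integral_noise, add_zero]

variable {S₀} in
theorem cov_param_reward (hS₀ : S₀.PosDef) (u : EuclideanSpace ℝ (Fin d))
    (p : (i : Fin K) × Fin (N i)) :
    cov[fun q => inner ℝ u q.1, fun q => q.2 p; jointLaw μ₀ S₀ x σ N] =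
      u.ofLp ⬝ᵥ S₀ *ᵥ (x p.1).ofLp := by
  rw [reward_eq x N p, covariance_add_right (memLp_param ..) (memLp_param ..) (memLp_noise ..),
    cov_param_param _ _ _ _ hS₀, cov_param_noise, add_zero]

variable {S₀} in
theorem cov_reward_reward (hS₀ : S₀.PosDef) (p p' : (i : Fin K) × Fin (N i)) :
    cov[fun q => q.2 p, fun q => q.2 p'; jointLaw μ₀ S₀ x σ N] =
      (x p.1).ofLp ⬝ᵥ S₀ *ᵥ (x p'.1).ofLp + if p = p' then σ ^ 2 else 0 := by
  rw [reward_eq x N p, covariance_add_left (memLp_param ..) (memLp_noise ..) (memLp_reward ..),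
    cov_param_reward _ _ _ _ hS₀, reward_eq x N p',
    covariance_add_right (memLp_noise ..) (memLp_param ..) (memLp_noise ..),
    cov_noise_noise, covariance_comm, cov_param_noise, zero_add]

end Moments

/-! ### Gram matrices and the posterior covariance -/

/-- The Gram matrix `∑ᵢ wᵢ xᵢ xᵢᵀ` of the features with weights `w`. -/
noncomputable def gram (x : Fin K → EuclideanSpace ℝ (Fin d)) (w : Fin K → ℝ) :
    Matrix (Fin d) (Fin d) ℝ :=
  ∑ i, w i • outer (x i) (x i)

/-- The posterior covariance `(S₀⁻¹ + σ⁻² ∑ᵢ wᵢ xᵢ xᵢᵀ)⁻¹` when arm `i` is pulled `wᵢ` times. -/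
noncomputable def posteriorCov (S₀ : Matrix (Fin d) (Fin d) ℝ)
    (x : Fin K → EuclideanSpace ℝ (Fin d)) (σ : ℝ) (w : Fin K → ℝ) : Matrix (Fin d) (Fin d) ℝ :=
  (S₀⁻¹ + (1 / σ ^ 2) • gram x w)⁻¹

theorem dotProduct_outer_mulVec (a b : Fin d → ℝ) (u v : EuclideanSpace ℝ (Fin d)) :
    a ⬝ᵥ outer u v *ᵥ b = (a ⬝ᵥ u.ofLp) * (v.ofLp ⬝ᵥ b) := by
  simp [outer, Matrix.vecMulVec_mulVec, dotProduct_smul, mul_comm]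

theorem dotProduct_gram_mulVec (x : Fin K → EuclideanSpace ℝ (Fin d)) (w : Fin K → ℝ)
    (a b : Fin d → ℝ) :
    a ⬝ᵥ gram x w *ᵥ b = ∑ i, w i * ((a ⬝ᵥ (x i).ofLp) * ((x i).ofLp ⬝ᵥ b)) := by
  simp [gram, Matrix.sum_mulVec, dotProduct_sum, Matrix.smul_mulVec, dotProduct_smul,
    dotProduct_outer_mulVec]

theorem posSemidef_gram (x : Fin K → EuclideanSpace ℝ (Fin d)) {w : Fin K → ℝ}
    (hw : ∀ i, 0 ≤ w i) : (gram x w).PosSemidef := by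
  refine Matrix.posSemidef_sum _ fun i _ => Matrix.PosSemidef.smul ?_ (hw i)
  simpa [outer] using Matrix.posSemidef_vecMulVec_self_star (x i).ofLp

theorem posDef_precision {S₀ : Matrix (Fin d) (Fin d) ℝ} (hS₀ : S₀.PosDef)
    (x : Fin K → EuclideanSpace ℝ (Fin d)) (σ : ℝ) {w : Fin K → ℝ} (hw : ∀ i, 0 ≤ w i) :
    (S₀⁻¹ + (1 / σ ^ 2) • gram x w).PosDef :=
  hS₀.inv.add_posSemidef ((posSemidef_gram x hw).smul (by positivity))

theorem posDef_posteriorCov {S₀ : Matrix (Fin d) (Fin d) ℝ} (hS₀ : S₀.PosDef)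
    (x : Fin K → EuclideanSpace ℝ (Fin d)) (σ : ℝ) {w : Fin K → ℝ} (hw : ∀ i, 0 ≤ w i) :
    (posteriorCov S₀ x σ w).PosDef :=
  (posDef_precision hS₀ x σ hw).inv

section Inverse

variable {S B P : Matrix (Fin d) (Fin d) ℝ}

theorem inv_add_mul_mul_add (hS : IsUnit S.det) (hP : IsUnit (S⁻¹ + B).det)
    (h : P = (S⁻¹ + B)⁻¹) : P * B * S + P = S := by
  have h1 : P * (S⁻¹ + B) = 1 := by rw [h, Matrix.nonsing_inv_mul _ hP]
  calc P * B * S + P = P * B * S + P * (S⁻¹ * S) := by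
        rw [Matrix.nonsing_inv_mul _ hS, mul_one]
    _ = (P * (S⁻¹ + B)) * S := by noncomm_ring
    _ = S := by rw [h1, one_mul]

theorem mul_mul_inv_add (hS : IsUnit S.det) (hP : IsUnit (S⁻¹ + B).det)
    (h : P = (S⁻¹ + B)⁻¹) : S * B * P = S - P := by
  have h1 : (S⁻¹ + B) * P = 1 := by rw [h, Matrix.mul_nonsing_inv _ hP]
  calc S * B * P = S * ((S⁻¹ + B) * P) - S * S⁻¹ * P := by noncomm_ring
    _ = S - P := by rw [h1, Matrix.mul_nonsing_inv _ hS, mul_one, one_mul]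

theorem sandwich_inv_add (hS : IsUnit S.det) (hP : IsUnit (S⁻¹ + B).det)
    (h : P = (S⁻¹ + B)⁻¹) : P * (B + B * S * B) * P = S - P := by
  calc P * (B + B * S * B) * P = (P * B * S + P) * B * P := by noncomm_ring
    _ = S - P := by rw [inv_add_mul_mul_add hS hP h, mul_mul_inv_add hS hP h]

end Inverse

theorem isUnit_det_of_posDef {A : Matrix (Fin d) (Fin d) ℝ} (hA : A.PosDef) : IsUnit A.det :=
  (Matrix.isUnit_iff_isUnit_det _).mp hA.isUnit

theorem sigmaHat_eq_posteriorCov (S₀ : Matrix (Fin d) (Fin d) ℝ)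
    (x : Fin K → EuclideanSpace ℝ (Fin d)) (σ : ℝ) (ω : Fin K → ℝ) (n : ℕ) :
    sigmaHat S₀ x σ ω n = posteriorCov S₀ x σ (fun i => ω i * n) := rfl

theorem gram_mul_mul_gram (S₀ : Matrix (Fin d) (Fin d) ℝ)
    (x : Fin K → EuclideanSpace ℝ (Fin d)) (w : Fin K → ℝ) :
    gram x w * S₀ * gram x w =
      ∑ i, ∑ j, (w i * w j * ((x i).ofLp ⬝ᵥ S₀ *ᵥ (x j).ofLp)) • outer (x i) (x j) := by
  simp only [gram, Finset.sum_mul, Finset.mul_sum]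
  rw [Finset.sum_comm]
  refine Finset.sum_congr rfl fun i _ => Finset.sum_congr rfl fun j _ => ?_
  have h : outer (x i) (x i) * S₀ * outer (x j) (x j) =
      ((x i).ofLp ⬝ᵥ S₀ *ᵥ (x j).ofLp) • outer (x i) (x j) := by
    rw [outer, outer, outer, Matrix.vecMulVec_mul, Matrix.vecMulVec_mul_vecMulVec,
      Matrix.dotProduct_mulVec, Matrix.vecMulVec_smul]
  rw [smul_mul_assoc, smul_mul_assoc, mul_smul_comm, h, smul_smul, smul_smul, mul_assoc]

/-- The explicit covariance of the posterior mean is the prior covariance minus the posterior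
covariance. -/
theorem covExplicit_eq_sub {S₀ : Matrix (Fin d) (Fin d) ℝ} (hS₀ : S₀.PosDef)
    (x : Fin K → EuclideanSpace ℝ (Fin d)) {σ : ℝ} (hσ : 0 < σ) {ω : Fin K → ℝ}
    (hω : ∀ i, 0 ≤ ω i) (n : ℕ) :
    covExplicit S₀ x σ ω n = S₀ - posteriorCov S₀ x σ (fun i => ω i * n) := by
  have hw : ∀ i, 0 ≤ ω i * (n : ℝ) := fun i => mul_nonneg (hω i) n.cast_nonneg
  have hmid : (∑ i, (ω i * n * (σ ^ 2 + ω i * n * sqNorm S₀ (x i))) • outer (x i) (x i) +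
      ∑ i, ∑ j ∈ Finset.univ.erase i,
        (ω i * ω j * (n : ℝ) ^ 2 * ((x i).ofLp ⬝ᵥ S₀ *ᵥ (x j).ofLp)) • outer (x i) (x j)) =
      (σ ^ 2) • gram x (fun i => ω i * n) +
        gram x (fun i => ω i * n) * S₀ * gram x (fun i => ω i * n) := by
    rw [gram_mul_mul_gram, gram, Finset.smul_sum, ← Finset.sum_add_distrib,
      ← Finset.sum_add_distrib]
    refine Finset.sum_congr rfl fun i _ => ?_
    rw [← Finset.add_sum_erase _ _ (Finset.mem_univ i), ← add_assoc, smul_smul, ← add_smul]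
    congr 1
    · congr 1
      simp only [sqNorm]; ring
    · refine Finset.sum_congr rfl fun j _ => ?_
      congr 1; ring
  rw [covExplicit, hmid, sigmaHat_eq_posteriorCov,
    ← sandwich_inv_add (isUnit_det_of_posDef hS₀)
      (isUnit_det_of_posDef (posDef_precision hS₀ x σ hw)) (posteriorCov.eq_1 ..)]
  rw [← smul_mul_assoc, ← mul_smul_comm]
  congr 2
  rw [smul_add, smul_smul, smul_mul_assoc, smul_mul_assoc, mul_smul_comm, smul_smul]
  congr 2
  · field_simp
  · field_simp

/-- `Σ̃ₙ = n Σ̂ₙ`. -/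
theorem sigmaTilde_eq_smul {S₀ : Matrix (Fin d) (Fin d) ℝ} (hS₀ : S₀.PosDef)
    (x : Fin K → EuclideanSpace ℝ (Fin d)) (σ : ℝ) {ω : Fin K → ℝ} (hω : ∀ i, 0 ≤ ω i) {n : ℕ}
    (hn : 1 ≤ n) :
    sigmaTilde S₀ x σ ω n = (n : ℝ) • posteriorCov S₀ x σ (fun i => ω i * n) := by
  have hn' : (n : ℝ) ≠ 0 := by positivity
  have hw : ∀ i, 0 ≤ ω i * (n : ℝ) := fun i => mul_nonneg (hω i) n.cast_nonneg
  have h : (1 / (n : ℝ)) • S₀⁻¹ + (1 / σ ^ 2) • ∑ i, ω i • outer (x i) (x i) =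
      (1 / (n : ℝ)) • (S₀⁻¹ + (1 / σ ^ 2) • gram x (fun i => ω i * n)) := by
    rw [smul_add, smul_comm (1 / (n : ℝ)) (1 / σ ^ 2), gram, Finset.smul_sum (r := 1 / (n : ℝ))]
    congr 2
    refine Finset.sum_congr rfl fun i _ => ?_
    rw [smul_smul]
    congr 1
    field_simp
  rw [sigmaTilde, h, posteriorCov]
  refine Matrix.inv_eq_left_inv ?_
  rw [smul_mul_assoc, mul_smul_comm, smul_smul,
    Matrix.nonsing_inv_mul _ (isUnit_det_of_posDef (posDef_precision hS₀ x σ hw)),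
    mul_one_div_cancel hn', one_smul]

theorem sqNorm_smul (c : ℝ) (A : Matrix (Fin d) (Fin d) ℝ) (v : EuclideanSpace ℝ (Fin d)) :
    sqNorm (c • A) v = c * sqNorm A v := by
  simp [sqNorm, Matrix.smul_mulVec, dotProduct_smul]

theorem sqNorm_sub (A B : Matrix (Fin d) (Fin d) ℝ) (v : EuclideanSpace ℝ (Fin d)) :
    sqNorm (A - B) v = sqNorm A v - sqNorm B v := by
  simp [sqNorm, Matrix.sub_mulVec, dotProduct_sub]

theorem sqNorm_pos {A : Matrix (Fin d) (Fin d) ℝ} (hA : A.PosDef) {v : EuclideanSpace ℝ (Fin d)}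
    (hv : v ≠ 0) : 0 < sqNorm A v := by
  have := hA.dotProduct_mulVec_pos (x := v.ofLp) (by simpa using hv)
  simpa [sqNorm] using this

/-- Cauchy–Schwarz with the two observed arms `i` and `j` alone bounds the posterior variance of
the gap between them. With `z = Σ̂ (xᵢ - xⱼ)` this variance is at once `zᵀ (xᵢ - xⱼ)` and
`zᵀ Σ̂⁻¹ z`, and the latter is at least `σ⁻² (wᵢ (zᵀ xᵢ)² + wⱼ (zᵀ xⱼ)²)`. -/
theorem sqNorm_posteriorCov_le {S₀ : Matrix (Fin d) (Fin d) ℝ} (hS₀ : S₀.PosDef)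
    (x : Fin K → EuclideanSpace ℝ (Fin d)) {σ : ℝ} (hσ : 0 < σ) {w : Fin K → ℝ}
    (hw : ∀ i, 0 ≤ w i) {i j : Fin K} (hij : i ≠ j) {b : ℝ} (hb : 0 < b) (hi : b ≤ w i)
    (hj : b ≤ w j) :
    sqNorm (posteriorCov S₀ x σ w) (x i - x j) ≤ 2 * σ ^ 2 / b := by
  set P := posteriorCov S₀ x σ w with hP
  set D : Fin d → ℝ := (x i - x j).ofLp with hD
  set z : Fin d → ℝ := P *ᵥ D with hz
  have hA := posDef_precision hS₀ x σ hw
  have hPsymm : Pᵀ = P := (posDef_posteriorCov hS₀ x σ hw).isHermitian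
  have hAz : (S₀⁻¹ + (1 / σ ^ 2) • gram x w) *ᵥ z = D := by
    rw [hz, Matrix.mulVec_mulVec, hP, posteriorCov,
      Matrix.mul_nonsing_inv _ (isUnit_det_of_posDef hA), Matrix.one_mulVec]
  have hs1 : sqNorm P (x i - x j) = z ⬝ᵥ (x i).ofLp - z ⬝ᵥ (x j).ofLp := by
    rw [← dotProduct_sub, dotProduct_comm]; rfl
  have hs2 : sqNorm P (x i - x j) =
      z ⬝ᵥ S₀⁻¹ *ᵥ z + 1 / σ ^ 2 * ∑ k, w k * (z ⬝ᵥ (x k).ofLp) ^ 2 := by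
    have : sqNorm P (x i - x j) = z ⬝ᵥ (S₀⁻¹ + (1 / σ ^ 2) • gram x w) *ᵥ z := by
      rw [hAz, dotProduct_comm]; rfl
    rw [this, Matrix.add_mulVec, dotProduct_add, Matrix.smul_mulVec, dotProduct_smul,
      dotProduct_gram_mulVec, smul_eq_mul]
    congr 2
    refine Finset.sum_congr rfl fun k _ => ?_
    rw [dotProduct_comm (x k).ofLp, sq]
  have h0 : 0 ≤ z ⬝ᵥ S₀⁻¹ *ᵥ z := by
    simpa using hS₀.inv.posSemidef.dotProduct_mulVec_nonneg z
  have h1 : b * ((z ⬝ᵥ (x i).ofLp) ^ 2 + (z ⬝ᵥ (x j).ofLp) ^ 2) ≤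
      ∑ k, w k * (z ⬝ᵥ (x k).ofLp) ^ 2 := by
    calc b * ((z ⬝ᵥ (x i).ofLp) ^ 2 + (z ⬝ᵥ (x j).ofLp) ^ 2)
        ≤ ∑ k ∈ {i, j}, w k * (z ⬝ᵥ (x k).ofLp) ^ 2 := by
          rw [Finset.sum_pair hij]
          nlinarith [mul_le_mul_of_nonneg_right hi (sq_nonneg (z ⬝ᵥ (x i).ofLp)),
            mul_le_mul_of_nonneg_right hj (sq_nonneg (z ⬝ᵥ (x j).ofLp))]
      _ ≤ _ := Finset.sum_le_sum_of_subset_of_nonneg (Finset.subset_univ _)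
          fun k _ _ => mul_nonneg (hw k) (sq_nonneg _)
  set s := sqNorm P (x i - x j) with hs
  set p := z ⬝ᵥ (x i).ofLp
  set q := z ⬝ᵥ (x j).ofLp
  set T := ∑ k, w k * (z ⬝ᵥ (x k).ofLp) ^ 2
  have h2 : T ≤ σ ^ 2 * s := by
    have : σ ^ 2 * s = σ ^ 2 * (z ⬝ᵥ S₀⁻¹ *ᵥ z) + T := by
      rw [hs2]; field_simp
    have := mul_nonneg (sq_nonneg σ) h0
    linarith
  have h3 : b * s ^ 2 ≤ 2 * (σ ^ 2 * s) := by
    have : s ^ 2 ≤ 2 * (p ^ 2 + q ^ 2) := by rw [hs1]; nlinarith [sq_nonneg (p + q)]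
    nlinarith [mul_le_mul_of_nonneg_left this hb.le]
  rw [le_div_iff₀ hb]
  by_contra! hcon
  have hspos : 0 < s := by
    by_contra! hneg
    have := mul_nonpos_of_nonpos_of_nonneg hneg hb.le
    have : 0 < 2 * σ ^ 2 := by positivity
    linarith
  nlinarith [mul_lt_mul_of_pos_right hcon hspos]

/-! ### A Gaussian sign change -/

/-- Chernoff bound for a centred real Gaussian. -/
theorem gaussianReal_real_Ici_le {s : ℝ≥0} (hs : 0 < s) {t : ℝ} (ht : 0 ≤ t) :
    (gaussianReal 0 s).real {z | t ≤ z} ≤ Real.exp (-t ^ 2 / (2 * s)) := by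
  have hs' : (0 : ℝ) < s := hs
  have h := measure_ge_le_exp_mul_mgf (μ := gaussianReal 0 s) (X := fun z => z) t
    (t := t / s) (by positivity) (integrable_exp_mul_gaussianReal _)
  rw [mgf_fun_id_gaussianReal, ← Real.exp_add] at h
  refine h.trans (le_of_eq ?_)
  congr 1
  field_simp
  ring

/-- The Gaussian integral `E[exp (-M² / 2s)]` for `M ∼ N(m, c)`. -/
theorem integral_exp_neg_sq_gaussianReal {s : ℝ} (hs : 0 < s) (m : ℝ) (c : ℝ≥0) :
    ∫ a, Real.exp (-a ^ 2 / (2 * s)) ∂gaussianReal m c =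
      1 / √(1 + c / s) * Real.exp (-m ^ 2 / (2 * (c + s))) := by
  rcases eq_or_ne c 0 with rfl | hc
  · simp
  have hc' : (0 : ℝ) < c := by positivity
  rw [integral_gaussianReal_eq_integral_smul hc]
  have hpt : ∀ a : ℝ, gaussianPDFReal m c a • Real.exp (-a ^ 2 / (2 * s)) =
      ((√(2 * Real.pi * c))⁻¹ * Real.exp (-m ^ 2 / (2 * (c + s)))) *
        Real.exp (-((c + s) / (2 * s * c)) * (a - m * s / (c + s)) ^ 2) := by
    intro a
    rw [gaussianPDFReal, smul_eq_mul, mul_assoc _ (Real.exp _), mul_assoc _ (Real.exp _),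
      ← Real.exp_add, ← Real.exp_add]
    congr 2
    field_simp
    ring
  simp_rw [hpt]
  rw [integral_const_mul, integral_sub_right_eq_self
    (fun a => Real.exp (-((c + s) / (2 * s * c)) * a ^ 2)), integral_gaussian]
  rw [mul_right_comm]
  congr 1
  rw [← Real.sqrt_inv, ← Real.sqrt_mul (by positivity), one_div, ← Real.sqrt_inv]
  congr 1
  have := Real.pi_pos
  field_simp
  ring

/-- A bound on the probability of `M ≤ 0 ≤ M + Z` for independent `M ∼ N(m, c)` and `Z ∼ N(0, s)`:
given `M = a ≤ 0`, the Chernoff bound for `-a ≤ Z` is `exp (-a² / 2s)`, which is then averaged over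
all of `M`. The variance `c` may vanish. -/
theorem measureReal_sign_change_le {Ω : Type*} {mΩ : MeasurableSpace Ω} {P : Measure Ω}
    {M Z : Ω → ℝ} {m : ℝ} {c s : ℝ≥0} (hs : 0 < s)
    (hM : HasLaw M (gaussianReal m c) P) (hZ : HasLaw Z (gaussianReal 0 s) P)
    (hMZ : IndepFun M Z P) :
    P.real {ω | M ω ≤ 0 ∧ 0 ≤ M ω + Z ω} ≤
      1 / √(1 + c / s) * Real.exp (-m ^ 2 / (2 * (c + s))) := by
  have hPM : IsProbabilityMeasure P := hM.isProbabilityMeasure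
  have hmap : P.map (fun ω => (M ω, Z ω)) = (gaussianReal m c).prod (gaussianReal 0 s) := by
    rw [(indepFun_iff_map_prod_eq_prod_map_map hM.aemeasurable hZ.aemeasurable).mp hMZ,
      hM.map_eq, hZ.map_eq]
  have hset : MeasurableSet {r : ℝ × ℝ | r.1 ≤ 0 ∧ 0 ≤ r.1 + r.2} :=
    (measurableSet_le measurable_fst measurable_const).inter
      (measurableSet_le measurable_const (measurable_fst.add measurable_snd))
  have h1 : P.real {ω | M ω ≤ 0 ∧ 0 ≤ M ω + Z ω} =
      ((gaussianReal m c).prod (gaussianReal 0 s)).real {r | r.1 ≤ 0 ∧ 0 ≤ r.1 + r.2} := by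
    rw [← hmap, measureReal_def, measureReal_def,
      Measure.map_apply_of_aemeasurable (hM.aemeasurable.prodMk hZ.aemeasurable) hset]
    rfl
  rw [h1, ← integral_exp_neg_sq_gaussianReal (s := s) hs m c, measureReal_def]
  have hint : Integrable (fun a => Real.exp (-a ^ 2 / (2 * s))) (gaussianReal m c) := by
    refine Integrable.of_bound (by fun_prop) 1 (Filter.Eventually.of_forall fun a => ?_)
    rw [Real.norm_eq_abs, Real.abs_exp, Real.exp_le_one_iff, neg_div, neg_nonpos]
    positivity
  refine ENNReal.toReal_le_of_le_ofReal (integral_nonneg fun a => (Real.exp_pos _).le) ?_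
  rw [ofReal_integral_eq_lintegral_ofReal hint
    (Filter.Eventually.of_forall fun a => (Real.exp_pos _).le), Measure.prod_apply hset]
  refine lintegral_mono fun a => ?_
  rcases le_or_gt a 0 with ha | ha
  · have h := gaussianReal_real_Ici_le hs (neg_nonneg.mpr ha)
    rw [neg_sq] at h
    have hpre : Prod.mk a ⁻¹' {r : ℝ × ℝ | r.1 ≤ 0 ∧ 0 ≤ r.1 + r.2} = {z | -a ≤ z} := by
      ext z
      simp [ha, neg_le_iff_add_nonneg']
    rw [hpre]
    exact (ENNReal.le_ofReal_iff_toReal_le (measure_ne_top _ _) (Real.exp_pos _).le).mpr h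
  · have hpre : Prod.mk a ⁻¹' {r : ℝ × ℝ | r.1 ≤ 0 ∧ 0 ≤ r.1 + r.2} = ∅ := by
      ext z
      simp [ha.not_ge]
    simp [hpre]

/-! ### Regression of the parameter on the history -/

section Posterior

variable (μ₀ : EuclideanSpace ℝ (Fin d)) (S₀ : Matrix (Fin d) (Fin d) ℝ)
  (x : Fin K → EuclideanSpace ℝ (Fin d)) (σ : ℝ) (N : Fin K → ℕ)

/-- The gain of the Bayesian linear regression: the linear map `y ↦ σ⁻² Σ̂ ∑ₚ yₚ xₚ`, where `Σ̂` is
the posterior covariance. -/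
noncomputable def gain : History N →L[ℝ] EuclideanSpace ℝ (Fin d) :=
  ∑ p, ((1 / σ ^ 2) • rewardCLM N p).smulRight
    (WithLp.toLp 2 (posteriorCov S₀ x σ (fun i => N i) *ᵥ (x p.1).ofLp))

theorem inner_gain (u : EuclideanSpace ℝ (Fin d)) (y : History N) :
    inner ℝ u (gain S₀ x σ N y) =
      ∑ p, (1 / σ ^ 2 * (u.ofLp ⬝ᵥ posteriorCov S₀ x σ (fun i => N i) *ᵥ (x p.1).ofLp)) * y p := by
  simp only [gain, sum_apply, inner_sum, ContinuousLinearMap.smulRight_apply,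
    inner_smul_right]
  refine Finset.sum_congr rfl fun p _ => ?_
  rw [EuclideanSpace.inner_eq_star_dotProduct, dotProduct_comm]
  simp [rewardCLM]
  ring

theorem sum_pulls (f : Fin K → ℝ) :
    ∑ p : (i : Fin K) × Fin (N i), f p.1 = ∑ i, (N i : ℝ) * f i := by
  simp [Fintype.sum_sigma]

variable {S₀ σ}

/-- The sum is `∑ₚ aₚ Cov(⟪u, θ⟫, yₚ)`, where `aₚ` are the coefficients of `⟪v, gain y⟫` in
`inner_gain`. Both the covariance of the parameter with the gain and that of the gain with itself
reduce to it. -/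
theorem sum_gain_mul_prior (hS₀ : S₀.PosDef) (u v : EuclideanSpace ℝ (Fin d)) :
    ∑ p : (i : Fin K) × Fin (N i),
      (1 / σ ^ 2 * (v.ofLp ⬝ᵥ posteriorCov S₀ x σ (fun i => N i) *ᵥ (x p.1).ofLp)) *
        (u.ofLp ⬝ᵥ S₀ *ᵥ (x p.1).ofLp) =
      u.ofLp ⬝ᵥ (S₀ - posteriorCov S₀ x σ (fun i => N i)) *ᵥ v.ofLp := by
  have hN : ∀ i, 0 ≤ (N i : ℝ) := fun i => (N i).cast_nonneg
  have hsymm : (posteriorCov S₀ x σ (fun i => N i))ᵀ = posteriorCov S₀ x σ (fun i => N i) :=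
    (posDef_posteriorCov hS₀ x σ hN).isHermitian
  rw [← mul_mul_inv_add (isUnit_det_of_posDef hS₀)
    (isUnit_det_of_posDef (posDef_precision hS₀ x σ hN)) (posteriorCov.eq_1 ..),
    sum_pulls N (fun i => (1 / σ ^ 2 * (v.ofLp ⬝ᵥ posteriorCov S₀ x σ (fun i => N i) *ᵥ
      (x i).ofLp)) * (u.ofLp ⬝ᵥ S₀ *ᵥ (x i).ofLp)),
    ← Matrix.mulVec_mulVec, ← Matrix.mulVec_mulVec, Matrix.dotProduct_mulVec _ S₀,
    Matrix.smul_mulVec, dotProduct_smul, dotProduct_gram_mulVec, smul_eq_mul, Finset.mul_sum]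
  refine Finset.sum_congr rfl fun i _ => ?_
  have : (x i).ofLp ⬝ᵥ posteriorCov S₀ x σ (fun i => N i) *ᵥ v.ofLp =
      v.ofLp ⬝ᵥ posteriorCov S₀ x σ (fun i => N i) *ᵥ (x i).ofLp := by
    conv_lhs => rw [← hsymm, Matrix.mulVec_transpose, dotProduct_comm, ← Matrix.dotProduct_mulVec]
  rw [this, ← Matrix.dotProduct_mulVec]
  ring

theorem cov_param_gain (hS₀ : S₀.PosDef) (u v : EuclideanSpace ℝ (Fin d)) :
    cov[fun q => inner ℝ u q.1, fun q => inner ℝ v (gain S₀ x σ N q.2); jointLaw μ₀ S₀ x σ N] =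
      u.ofLp ⬝ᵥ (S₀ - posteriorCov S₀ x σ (fun i => N i)) *ᵥ v.ofLp := by
  simp_rw [inner_gain]
  rw [covariance_fun_sum_right (fun p => (memLp_reward μ₀ S₀ x σ N p).const_mul _)
    (memLp_param ..)]
  simp_rw [covariance_const_mul_right, cov_param_reward _ _ _ _ hS₀]
  exact sum_gain_mul_prior x N hS₀ u v

theorem cov_gain_reward (hS₀ : S₀.PosDef) (hσ : 0 < σ) (v : EuclideanSpace ℝ (Fin d))
    (p' : (i : Fin K) × Fin (N i)) :
    cov[fun q => inner ℝ v (gain S₀ x σ N q.2), fun q => q.2 p'; jointLaw μ₀ S₀ x σ N] =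
      v.ofLp ⬝ᵥ S₀ *ᵥ (x p'.1).ofLp := by
  have hN : ∀ i, 0 ≤ (N i : ℝ) := fun i => (N i).cast_nonneg
  simp_rw [inner_gain]
  rw [covariance_fun_sum_left (fun p => (memLp_reward μ₀ S₀ x σ N p).const_mul _)
    (memLp_reward ..)]
  simp_rw [covariance_const_mul_left, cov_reward_reward _ _ _ _ hS₀, mul_add]
  rw [Finset.sum_add_distrib]
  set P := posteriorCov S₀ x σ (fun i => N i) with hP
  have h1 : ∑ p : (i : Fin K) × Fin (N i),
      (1 / σ ^ 2 * (v.ofLp ⬝ᵥ P *ᵥ (x p.1).ofLp)) * ((x p.1).ofLp ⬝ᵥ S₀ *ᵥ (x p'.1).ofLp) =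
      v.ofLp ⬝ᵥ (P * ((1 / σ ^ 2) • gram x (fun i => N i)) * S₀) *ᵥ (x p'.1).ofLp := by
    rw [sum_pulls N (fun i => (1 / σ ^ 2 * (v.ofLp ⬝ᵥ P *ᵥ (x i).ofLp)) *
        ((x i).ofLp ⬝ᵥ S₀ *ᵥ (x p'.1).ofLp)),
      ← Matrix.mulVec_mulVec, ← Matrix.mulVec_mulVec, Matrix.dotProduct_mulVec _ P,
      Matrix.smul_mulVec, dotProduct_smul, dotProduct_gram_mulVec, smul_eq_mul, Finset.mul_sum]
    refine Finset.sum_congr rfl fun i _ => ?_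
    rw [← Matrix.dotProduct_mulVec]
    ring
  have h2 : ∑ p : (i : Fin K) × Fin (N i),
      (1 / σ ^ 2 * (v.ofLp ⬝ᵥ P *ᵥ (x p.1).ofLp)) * (if p = p' then σ ^ 2 else 0) =
      v.ofLp ⬝ᵥ P *ᵥ (x p'.1).ofLp := by
    simp only [mul_ite, mul_zero, Finset.sum_ite_eq', Finset.mem_univ, if_true]
    field_simp
  rw [h1, h2, ← dotProduct_add, ← Matrix.add_mulVec,
    inv_add_mul_mul_add (isUnit_det_of_posDef hS₀)
      (isUnit_det_of_posDef (posDef_precision hS₀ x σ hN)) (posteriorCov.eq_1 ..)]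

theorem memLp_gain (v : EuclideanSpace ℝ (Fin d)) :
    MemLp (fun q : EuclideanSpace ℝ (Fin d) × History N => inner ℝ v (gain S₀ x σ N q.2)) 2
      (jointLaw μ₀ S₀ x σ N) := by
  simp_rw [inner_gain]
  exact memLp_finsetSum _ fun p _ => (memLp_reward μ₀ S₀ x σ N p).const_mul _

theorem cov_gain_gain (hS₀ : S₀.PosDef) (hσ : 0 < σ) (u v : EuclideanSpace ℝ (Fin d)) :
    cov[fun q => inner ℝ u (gain S₀ x σ N q.2), fun q => inner ℝ v (gain S₀ x σ N q.2);
      jointLaw μ₀ S₀ x σ N] =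
      u.ofLp ⬝ᵥ (S₀ - posteriorCov S₀ x σ (fun i => N i)) *ᵥ v.ofLp := by
  conv_lhs => enter [2, q]; rw [inner_gain]
  rw [covariance_fun_sum_right (fun p => (memLp_reward μ₀ S₀ x σ N p).const_mul _)
    (memLp_gain ..)]
  simp_rw [covariance_const_mul_right, cov_gain_reward _ _ _ hS₀ hσ]
  exact sum_gain_mul_prior x N hS₀ u v

theorem cov_residual_residual (hS₀ : S₀.PosDef) (hσ : 0 < σ) (u v : EuclideanSpace ℝ (Fin d)) :
    cov[fun q => inner ℝ u (q.1 - gain S₀ x σ N q.2), fun q => inner ℝ v (q.1 - gain S₀ x σ N q.2);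
      jointLaw μ₀ S₀ x σ N] =
      u.ofLp ⬝ᵥ posteriorCov S₀ x σ (fun i => N i) *ᵥ v.ofLp := by
  simp_rw [inner_sub_right]
  rw [covariance_fun_sub_fun_sub (memLp_param ..) (memLp_gain ..) (memLp_param ..) (memLp_gain ..),
    cov_param_param _ _ _ _ hS₀, cov_param_gain _ _ _ hS₀, covariance_comm, cov_param_gain _ _ _ hS₀,
    cov_gain_gain _ _ _ hS₀ hσ]
  have hsymm : (S₀ - posteriorCov S₀ x σ (fun i => N i))ᵀ = S₀ - posteriorCov S₀ x σ (fun i => N i) :=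
    hS₀.isHermitian.sub (posDef_posteriorCov hS₀ x σ fun i => (N i).cast_nonneg).isHermitian
  have : v.ofLp ⬝ᵥ (S₀ - posteriorCov S₀ x σ (fun i => N i)) *ᵥ u.ofLp =
      u.ofLp ⬝ᵥ (S₀ - posteriorCov S₀ x σ (fun i => N i)) *ᵥ v.ofLp := by
    conv_lhs => rw [← hsymm, Matrix.mulVec_transpose, dotProduct_comm, ← Matrix.dotProduct_mulVec]
  rw [this, Matrix.sub_mulVec, dotProduct_sub]
  ring

/-- The parameter minus its linear regression on the history is independent of the history: the
two are jointly Gaussian and uncorrelated. -/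
theorem indepFun_residual_history (hS₀ : S₀.PosDef) (hσ : 0 < σ) :
    IndepFun (fun q : EuclideanSpace ℝ (Fin d) × History N => q.1 - gain S₀ x σ N q.2) Prod.snd
      (jointLaw μ₀ S₀ x σ N) := by
  have hG : HasGaussianLaw (fun q : EuclideanSpace ℝ (Fin d) × History N =>
      (q.1 - gain S₀ x σ N q.2, q.2)) (jointLaw μ₀ S₀ x σ N) := by
    let L : (EuclideanSpace ℝ (Fin d) × History N) →L[ℝ] (EuclideanSpace ℝ (Fin d) × History N) :=
      ((ContinuousLinearMap.fst ℝ _ _) - (gain S₀ x σ N).comp (ContinuousLinearMap.snd ℝ _ _)).prod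
        (ContinuousLinearMap.snd ℝ _ _)
    exact IsGaussian.hasGaussianLaw_id.map L
  refine hG.indepFun_of_covariance_strongDual fun L₁ L₂ => ?_
  have h1 : (L₁ ∘ fun q : EuclideanSpace ℝ (Fin d) × History N => q.1 - gain S₀ x σ N q.2) =
      (fun q => inner ℝ ((InnerProductSpace.toDual ℝ _).symm L₁) q.1) -
        fun q => inner ℝ ((InnerProductSpace.toDual ℝ _).symm L₁) (gain S₀ x σ N q.2) := by
    funext q
    simp [InnerProductSpace.toDual_symm_apply]
  have h2 : (L₂ ∘ Prod.snd : EuclideanSpace ℝ (Fin d) × History N → ℝ) =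
      fun q => ∑ p, L₂ (Pi.single p 1) * q.2 p := by
    funext q
    have : q.2 = ∑ p, q.2 p • (Pi.single p 1 : History N) := by
      simpa using (pi_eq_sum_univ' q.2)
    conv_lhs => rw [Function.comp_apply, this, map_sum]
    simp [mul_comm]
  have h3 := (memLp_param μ₀ S₀ x σ N ((InnerProductSpace.toDual ℝ _).symm L₁)).sub
    (memLp_gain μ₀ x N ((InnerProductSpace.toDual ℝ _).symm L₁))
  rw [h1, h2, covariance_fun_sum_right (fun p => (memLp_reward μ₀ S₀ x σ N p).const_mul _) h3]
  refine Finset.sum_eq_zero fun p _ => ?_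
  rw [covariance_const_mul_right, covariance_sub_left (memLp_param ..) (memLp_gain ..)
    (memLp_reward ..), cov_param_reward _ _ _ _ hS₀, cov_gain_reward _ _ _ hS₀ hσ, sub_self,
    mul_zero]

variable (S₀ σ)

/-- The posterior mean as an explicit function of the history: the prior mean, corrected by the
gain applied to the deviation of the rewards from their prior means. -/
noncomputable def estimator (y : History N) : EuclideanSpace ℝ (Fin d) :=
  μ₀ + gain S₀ x σ N (y - fun p => inner ℝ (x p.1) μ₀)

theorem measurable_estimator : Measurable (estimator μ₀ S₀ x σ N) := by
  unfold estimator
  fun_prop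

theorem integral_gain :
    ∫ q, gain S₀ x σ N q.2 ∂(jointLaw μ₀ S₀ x σ N) = gain S₀ x σ N (fun p => inner ℝ (x p.1) μ₀) := by
  have hint : Integrable (fun q : EuclideanSpace ℝ (Fin d) × History N => q.2)
      (jointLaw μ₀ S₀ x σ N) :=
    Integrable.of_eval fun p => (memLp_reward μ₀ S₀ x σ N p).integrable one_le_two
  rw [ContinuousLinearMap.integral_comp_comm _ hint]
  congr 1
  funext p
  rw [eval_integral fun p => (memLp_reward μ₀ S₀ x σ N p).integrable one_le_two]
  exact integral_reward μ₀ S₀ x σ N p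

end Posterior

/-! ### The posterior mean and the error bound -/

theorem covariance_congr_ae {Ω : Type*} {mΩ : MeasurableSpace Ω} {P : Measure Ω}
    {X X' Y Y' : Ω → ℝ} (hX : X =ᵐ[P] X') (hY : Y =ᵐ[P] Y') : cov[X, Y; P] = cov[X', Y'; P] := by
  rw [covariance, covariance, integral_congr_ae hX, integral_congr_ae hY]
  refine integral_congr_ae ?_
  filter_upwards [hX, hY] with ω h1 h2
  rw [h1, h2]

section Posterior

variable (μ₀ : EuclideanSpace ℝ (Fin d)) (S₀ : Matrix (Fin d) (Fin d) ℝ)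
  (x : Fin K → EuclideanSpace ℝ (Fin d)) (σ : ℝ) (N : Fin K → ℕ)

theorem estimator_eq (y : History N) :
    estimator μ₀ S₀ x σ N y =
      (μ₀ - gain S₀ x σ N (fun p => inner ℝ (x p.1) μ₀)) + gain S₀ x σ N y := by
  rw [estimator, map_sub]
  abel

theorem integrable_param :
    Integrable (fun q : EuclideanSpace ℝ (Fin d) × History N => q.1) (jointLaw μ₀ S₀ x σ N) := by
  have h : MeasurePreserving Prod.fst (jointLaw μ₀ S₀ x σ N) (multivariateGaussian μ₀ S₀) :=
    ⟨measurable_fst, fst_jointLaw μ₀ S₀ x σ N⟩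
  exact h.integrable_comp_of_integrable IsGaussian.integrable_id

theorem integrable_gain :
    Integrable (fun q : EuclideanSpace ℝ (Fin d) × History N => gain S₀ x σ N q.2)
      (jointLaw μ₀ S₀ x σ N) :=
  (gain S₀ x σ N).integrable_comp
    (Integrable.of_eval fun p => (memLp_reward μ₀ S₀ x σ N p).integrable one_le_two)

theorem integrable_estimator :
    Integrable (fun q : EuclideanSpace ℝ (Fin d) × History N => estimator μ₀ S₀ x σ N q.2)
      (jointLaw μ₀ S₀ x σ N) := by
  simp_rw [estimator_eq]
  exact (integrable_const _).add (integrable_gain μ₀ S₀ x σ N)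

theorem integral_fst_jointLaw : ∫ q, q.1 ∂(jointLaw μ₀ S₀ x σ N) = μ₀ := by
  have h := integral_map (μ := jointLaw μ₀ S₀ x σ N) (φ := Prod.fst) (by fun_prop)
    (f := fun θ => θ) (by fun_prop)
  rw [← h, fst_jointLaw, integral_id_multivariateGaussian]

theorem integral_sub_estimator :
    ∫ q, (q.1 - estimator μ₀ S₀ x σ N q.2) ∂(jointLaw μ₀ S₀ x σ N) = 0 := by
  rw [integral_sub (integrable_param ..) (integrable_estimator ..), integral_fst_jointLaw]
  simp_rw [estimator_eq]
  rw [integral_add (integrable_const _) (integrable_gain ..), integral_gain]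
  simp

variable {S₀ σ}

theorem indepFun_sub_estimator (hS₀ : S₀.PosDef) (hσ : 0 < σ) :
    IndepFun (fun q : EuclideanSpace ℝ (Fin d) × History N => q.1 - estimator μ₀ S₀ x σ N q.2)
      Prod.snd (jointLaw μ₀ S₀ x σ N) := by
  have h := (indepFun_residual_history μ₀ x N hS₀ hσ).comp
    (φ := fun r => r - (μ₀ - gain S₀ x σ N (fun p => inner ℝ (x p.1) μ₀))) (ψ := id)
    (by fun_prop) measurable_id
  have h1 : (fun q : EuclideanSpace ℝ (Fin d) × History N => q.1 - estimator μ₀ S₀ x σ N q.2) =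
      (fun r => r - (μ₀ - gain S₀ x σ N (fun p => inner ℝ (x p.1) μ₀))) ∘
        fun q => q.1 - gain S₀ x σ N q.2 := by
    funext q
    simp only [Function.comp_apply, estimator_eq]
    abel
  rw [h1]
  exact h

theorem posteriorMean_ae_eq (hS₀ : S₀.PosDef) (hσ : 0 < σ) :
    posteriorMean μ₀ S₀ x σ N =ᵐ[jointLaw μ₀ S₀ x σ N] fun q => estimator μ₀ S₀ x σ N q.2 := by
  have hle : historySigma d N ≤
      (inferInstance : MeasurableSpace (EuclideanSpace ℝ (Fin d) × History N)) := measurable_snd.comap_le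
  have hR : Measurable fun q : EuclideanSpace ℝ (Fin d) × History N =>
      q.1 - estimator μ₀ S₀ x σ N q.2 :=
    measurable_fst.sub ((measurable_estimator μ₀ S₀ x σ N).comp measurable_snd)
  have hT : StronglyMeasurable[historySigma d N]
      fun q : EuclideanSpace ℝ (Fin d) × History N => estimator μ₀ S₀ x σ N q.2 :=
    ((measurable_estimator μ₀ S₀ x σ N).comp (comap_measurable Prod.snd)).stronglyMeasurable
  have h1 := condExp_indep_eq (m₁ := MeasurableSpace.comap (fun q => q.1 - estimator μ₀ S₀ x σ N q.2)
    inferInstance) hR.comap_le hle (comap_measurable _).stronglyMeasurable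
    ((IndepFun_iff_Indep _ _ _).mp (indepFun_sub_estimator μ₀ x N hS₀ hσ))
  have h2 := condExp_add ((integrable_param μ₀ S₀ x σ N).sub (integrable_estimator μ₀ S₀ x σ N))
    (integrable_estimator μ₀ S₀ x σ N) (historySigma d N)
  have h3 : ((fun q : EuclideanSpace ℝ (Fin d) × History N => q.1) -
      (fun q => estimator μ₀ S₀ x σ N q.2)) + (fun q => estimator μ₀ S₀ x σ N q.2) =
      fun q => q.1 := by
    funext q; simp
  rw [h3, condExp_of_stronglyMeasurable hle hT (integrable_estimator μ₀ S₀ x σ N)] at h2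
  filter_upwards [h1, h2] with q hq1 hq2
  rw [posteriorMean, hq2, Pi.add_apply]
  rw [integral_sub_estimator] at hq1
  erw [hq1, zero_add]

theorem posteriorReward_ae_eq (hS₀ : S₀.PosDef) (hσ : 0 < σ) (i : Fin K) :
    posteriorReward μ₀ S₀ x σ N i =ᵐ[jointLaw μ₀ S₀ x σ N]
      fun q => inner ℝ (x i) (estimator μ₀ S₀ x σ N q.2) := by
  have h := (innerSL ℝ (x i)).comp_condExp_comm (m := historySigma d N)
    (integrable_param μ₀ S₀ x σ N)
  have h2 : (innerSL ℝ (x i) ∘ fun q : EuclideanSpace ℝ (Fin d) × History N => q.1) =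
      fun q => meanReward x q.1 i := by
    funext q
    simp [meanReward, real_inner_comm]
  rw [h2] at h
  filter_upwards [h, posteriorMean_ae_eq μ₀ x N hS₀ hσ] with q hq1 hq2
  rw [posteriorReward, ← hq1, Function.comp_apply, ← hq2]
  rfl

/-- The law of total covariance: `Cov(E[θ | H]) = S₀ - Σ̂`. -/
theorem covPosteriorMean_eq (hS₀ : S₀.PosDef) (hσ : 0 < σ) :
    covPosteriorMean μ₀ S₀ x σ N = S₀ - posteriorCov S₀ x σ (fun i => N i) := by
  ext a b
  have hcoord : ∀ a, (fun q => posteriorMean μ₀ S₀ x σ N q a) =ᵐ[jointLaw μ₀ S₀ x σ N]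
      fun q => inner ℝ (EuclideanSpace.single a (1 : ℝ))
        (μ₀ - gain S₀ x σ N (fun p => inner ℝ (x p.1) μ₀)) +
        inner ℝ (EuclideanSpace.single a (1 : ℝ)) (gain S₀ x σ N q.2) := by
    intro a
    filter_upwards [posteriorMean_ae_eq μ₀ x N hS₀ hσ] with q hq
    rw [hq, estimator_eq, ← inner_add_right, EuclideanSpace.inner_single_left]
    simp
  have hi : ∀ a, Integrable (fun q => inner ℝ (EuclideanSpace.single a (1 : ℝ))
      (gain S₀ x σ N q.2)) (jointLaw μ₀ S₀ x σ N) :=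
    fun a => (memLp_gain μ₀ x N _).integrable one_le_two
  rw [covPosteriorMean, Matrix.of_apply, covariance_congr_ae (hcoord a) (hcoord b),
    covariance_const_add_left (hi a), covariance_const_add_right (hi b),
    cov_gain_gain _ _ _ hS₀ hσ]
  simp

theorem sqNorm_posteriorMean_nonneg (hS₀ : S₀.PosDef) (hσ : 0 < σ)
    (u : EuclideanSpace ℝ (Fin d)) :
    0 ≤ sqNorm (S₀ - posteriorCov S₀ x σ (fun i => N i)) u := by
  rw [sqNorm, ← cov_gain_gain 0 x N hS₀ hσ, covariance_self (memLp_gain ..).aemeasurable]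
  exact variance_nonneg _ _

theorem hasLaw_estimator (hS₀ : S₀.PosDef) (hσ : 0 < σ) (u : EuclideanSpace ℝ (Fin d)) :
    HasLaw (fun q => inner ℝ u (estimator μ₀ S₀ x σ N q.2))
      (gaussianReal (inner ℝ u μ₀)
        (sqNorm (S₀ - posteriorCov S₀ x σ (fun i => N i)) u).toNNReal)
      (jointLaw μ₀ S₀ x σ N) := by
  let L : (EuclideanSpace ℝ (Fin d) × History N) →L[ℝ] ℝ :=
    (innerSL ℝ u).comp ((gain S₀ x σ N).comp (ContinuousLinearMap.snd ℝ _ _))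
  have hL : (L : EuclideanSpace ℝ (Fin d) × History N → ℝ) =
    fun q => inner ℝ u (gain S₀ x σ N q.2) := rfl
  have hlaw : HasLaw L (gaussianReal _ _) (jointLaw μ₀ S₀ x σ N) :=
    ⟨by fun_prop, IsGaussian.map_eq_gaussianReal L⟩
  rw [← covariance_self (by fun_prop), hL, cov_gain_gain _ _ _ hS₀ hσ,
    integral_inner (integrable_gain ..), integral_gain] at hlaw
  have h := gaussianReal_const_add hlaw
    (inner ℝ u (μ₀ - gain S₀ x σ N (fun p => inner ℝ (x p.1) μ₀)))
  rw [← inner_add_right, add_sub_cancel] at h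
  simpa only [estimator_eq, inner_add_right, sqNorm] using h

theorem hasLaw_sub_estimator (hS₀ : S₀.PosDef) (hσ : 0 < σ) (u : EuclideanSpace ℝ (Fin d)) :
    HasLaw (fun q => inner ℝ u (q.1 - estimator μ₀ S₀ x σ N q.2))
      (gaussianReal 0 (sqNorm (posteriorCov S₀ x σ (fun i => N i)) u).toNNReal)
      (jointLaw μ₀ S₀ x σ N) := by
  let L : (EuclideanSpace ℝ (Fin d) × History N) →L[ℝ] ℝ :=
    (innerSL ℝ u).comp (ContinuousLinearMap.fst ℝ _ _ -
      (gain S₀ x σ N).comp (ContinuousLinearMap.snd ℝ _ _))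
  have hL : (L : EuclideanSpace ℝ (Fin d) × History N → ℝ) =
    fun q => inner ℝ u (q.1 - gain S₀ x σ N q.2) := rfl
  have hmean : ∫ q, inner ℝ u (q.1 - gain S₀ x σ N q.2) ∂(jointLaw μ₀ S₀ x σ N) =
      inner ℝ u (μ₀ - gain S₀ x σ N (fun p => inner ℝ (x p.1) μ₀)) := by
    simp_rw [inner_sub_right]
    rw [integral_sub ((memLp_param ..).integrable one_le_two)
      ((memLp_gain ..).integrable one_le_two), integral_param,
      integral_inner (integrable_gain ..), integral_gain]
  have hlaw : HasLaw L (gaussianReal _ _) (jointLaw μ₀ S₀ x σ N) :=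
    ⟨by fun_prop, IsGaussian.map_eq_gaussianReal L⟩
  rw [← covariance_self (by fun_prop), hL, cov_residual_residual _ _ _ hS₀ hσ,
    hmean] at hlaw
  have h := gaussianReal_sub_const hlaw
    (inner ℝ u (μ₀ - gain S₀ x σ N (fun p => inner ℝ (x p.1) μ₀)))
  rw [sub_self] at h
  have he : (fun q : EuclideanSpace ℝ (Fin d) × History N =>
      inner ℝ u (q.1 - estimator μ₀ S₀ x σ N q.2)) = fun q =>
      inner ℝ u (q.1 - gain S₀ x σ N q.2) -
        inner ℝ u (μ₀ - gain S₀ x σ N (fun p => inner ℝ (x p.1) μ₀)) := by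
    funext q
    rw [← inner_sub_right, estimator_eq]
    congr 1
    abel
  rw [he]
  exact h

theorem expectedPoE_eq {best : EuclideanSpace ℝ (Fin d) → Fin K} {J : History N → Fin K}
    (hbest : Measurable best) (hJ : Measurable J) :
    expectedPoE μ₀ S₀ x σ N best J = (jointLaw μ₀ S₀ x σ N).real {q | J q.2 ≠ best q.1} := by
  have hs : MeasurableSet {q : EuclideanSpace ℝ (Fin d) × History N | J q.2 ≠ best q.1} :=
    (measurableSet_eq_fun (hJ.comp measurable_snd) (hbest.comp measurable_fst)).compl
  rw [measureReal_def, jointLaw, Measure.compProd_apply hs, expectedPoE, ← integral_toReal]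
  · rfl
  · exact (Kernel.measurable_kernel_prodMk_left hs).aemeasurable
  · exact Filter.Eventually.of_forall fun θ => measure_lt_top _ _

/-- The Bayes error is at most the sum over ordered pairs of arms of the probability that the sign
of the gap disagrees with the sign of its posterior mean. -/
theorem expectedPoE_le (hS₀ : S₀.PosDef) (hσ : 0 < σ) (hx : ∀ i j, i ≠ j → x i ≠ x j)
    {best : EuclideanSpace ℝ (Fin d) → Fin K} {J : History N → Fin K}
    (hbest : IsBestArm x best) (hJ : IsDecisionRule μ₀ S₀ x σ N J) :
    expectedPoE μ₀ S₀ x σ N best J ≤ ∑ i, ∑ j ∈ Finset.univ.erase i,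
      1 / √(1 + sqNorm (S₀ - posteriorCov S₀ x σ (fun i => N i)) (x i - x j) /
          sqNorm (posteriorCov S₀ x σ (fun i => N i)) (x i - x j)) *
        Real.exp (-(inner ℝ μ₀ (x i) - inner ℝ μ₀ (x j)) ^ 2 /
          (2 * sqNorm S₀ (x i - x j))) := by
  have hN : ∀ i, 0 ≤ (N i : ℝ) := fun i => (N i).cast_nonneg
  let E : Fin K → Fin K → Set (EuclideanSpace ℝ (Fin d) × History N) := fun i j =>
    {q | inner ℝ (x i - x j) (estimator μ₀ S₀ x σ N q.2) ≤ 0 ∧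
      0 ≤ inner ℝ (x i - x j) (estimator μ₀ S₀ x σ N q.2) +
        inner ℝ (x i - x j) (q.1 - estimator μ₀ S₀ x σ N q.2)}
  have hsub : ({q | J q.2 ≠ best q.1} : Set (EuclideanSpace ℝ (Fin d) × History N))
      ≤ᵐ[jointLaw μ₀ S₀ x σ N] ⋃ i, ⋃ j ∈ Finset.univ.erase i, E i j := by
    filter_upwards [hJ.argmax, ae_all_iff.mpr fun i => posteriorReward_ae_eq μ₀ x N hS₀ hσ i]
      with q hq hr hne
    refine Set.mem_iUnion.mpr ⟨best q.1, Set.mem_iUnion₂.mpr ⟨J q.2,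
      Finset.mem_erase.mpr ⟨hne, Finset.mem_univ _⟩, ?_, ?_⟩⟩
    · have := hq (best q.1)
      rw [hr, hr] at this
      rw [inner_sub_left]
      linarith
    · have := hbest.argmax q.1 (J q.2)
      rw [meanReward, meanReward, real_inner_comm, real_inner_comm (x (best q.1))] at this
      rw [← inner_add_right, add_sub_cancel, inner_sub_left]
      linarith
  rw [expectedPoE_eq μ₀ x N hbest.measurable hJ.measurable]
  calc (jointLaw μ₀ S₀ x σ N).real {q | J q.2 ≠ best q.1}
      ≤ (jointLaw μ₀ S₀ x σ N).real (⋃ i, ⋃ j ∈ Finset.univ.erase i, E i j) :=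
        ENNReal.toReal_mono (measure_ne_top _ _) (measure_mono_ae hsub)
    _ ≤ ∑ i, ∑ j ∈ Finset.univ.erase i, (jointLaw μ₀ S₀ x σ N).real (E i j) :=
        (measureReal_iUnion_fintype_le _).trans
          (Finset.sum_le_sum fun i _ => measureReal_biUnion_finset_le _ _)
    _ ≤ _ := Finset.sum_le_sum fun i _ => Finset.sum_le_sum fun j hj => ?_
  have hij : x i - x j ≠ 0 := sub_ne_zero.mpr (hx i j (Finset.ne_of_mem_erase hj).symm)
  have hs := sqNorm_pos (posDef_posteriorCov hS₀ x σ hN) hij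
  have hind := (indepFun_sub_estimator μ₀ x N hS₀ hσ).symm.comp
    (φ := fun y => inner ℝ (x i - x j) (estimator μ₀ S₀ x σ N y))
    (ψ := fun r => inner ℝ (x i - x j) r)
    (Measurable.inner measurable_const (measurable_estimator μ₀ S₀ x σ N)) (by fun_prop)
  have h := measureReal_sign_change_le (Real.toNNReal_pos.mpr hs)
    (hasLaw_estimator μ₀ x N hS₀ hσ (x i - x j)) (hasLaw_sub_estimator μ₀ x N hS₀ hσ (x i - x j))
    hind
  have hc := sqNorm_posteriorMean_nonneg x N hS₀ hσ (x i - x j)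
  rw [Real.coe_toNNReal _ hs.le, Real.coe_toNNReal _ hc, sqNorm_sub, sub_add_cancel,
    ← real_inner_comm (x i - x j), inner_sub_right] at h
  rw [sqNorm_sub]
  exact h

end Posterior

/-! ### The rate of convergence -/

theorem expectedPoE_le_one (μ₀ : EuclideanSpace ℝ (Fin d)) (S₀ : Matrix (Fin d) (Fin d) ℝ)
    (x : Fin K → EuclideanSpace ℝ (Fin d)) (σ : ℝ) (N : Fin K → ℕ)
    {best : EuclideanSpace ℝ (Fin d) → Fin K} {J : History N → Fin K}
    (hbest : Measurable best) (hJ : Measurable J) : expectedPoE μ₀ S₀ x σ N best J ≤ 1 := by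
  rw [expectedPoE_eq μ₀ x N hbest hJ]
  exact measureReal_le_one

theorem pulls_eq_of_exists_nat {ω : Fin K → ℝ} {n : ℕ} (h : ∀ i, ∃ m : ℕ, ω i * n = m) :
    (fun i => (pulls ω n i : ℝ)) = fun i => ω i * n := by
  funext i
  obtain ⟨m, hm⟩ := h i
  rw [pulls, hm, Nat.floor_natCast]

theorem half_le_floor {t : ℝ} (ht : 1 ≤ t) : t / 2 ≤ (⌊t⌋₊ : ℝ) := by
  have h1 : (1 : ℝ) ≤ ⌊t⌋₊ := by exact_mod_cast Nat.one_le_floor_iff t |>.mpr ht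
  have h2 := Nat.lt_floor_add_one t
  linarith

/-- When every arm is pulled at least `b` times, each pair of arms contributes `O(1 / √b)` to the
bound on the error, since the posterior variance of the gap is `O(1 / b)`. -/
theorem pair_bound_le {S₀ : Matrix (Fin d) (Fin d) ℝ} (hS₀ : S₀.PosDef)
    (x : Fin K → EuclideanSpace ℝ (Fin d)) {σ : ℝ} (hσ : 0 < σ) {w : Fin K → ℝ}
    (hw : ∀ i, 0 ≤ w i) {i j : Fin K} (hij : i ≠ j) (hx : x i ≠ x j) {b : ℝ} (hb : 0 < b)
    (hi : b ≤ w i) (hj : b ≤ w j) (r : ℝ) :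
    1 / √(1 + sqNorm (S₀ - posteriorCov S₀ x σ w) (x i - x j) /
          sqNorm (posteriorCov S₀ x σ w) (x i - x j)) *
        Real.exp (-r ^ 2 / (2 * sqNorm S₀ (x i - x j))) ≤
      √(2 * σ ^ 2 / sqNorm S₀ (x i - x j)) / √b := by
  have hs := sqNorm_pos (posDef_posteriorCov hS₀ x σ hw) (sub_ne_zero.mpr hx)
  have hv := sqNorm_pos hS₀ (sub_ne_zero.mpr hx)
  have hle := sqNorm_posteriorCov_le hS₀ x hσ hw hij hb hi hj
  rw [sqNorm_sub]
  set s := sqNorm (posteriorCov S₀ x σ w) (x i - x j)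
  set v := sqNorm S₀ (x i - x j)
  have h1 : 1 + (v - s) / s = (s / v)⁻¹ := by field_simp; ring
  have h2 : Real.exp (-r ^ 2 / (2 * v)) ≤ 1 := by
    rw [Real.exp_le_one_iff, neg_div, neg_nonpos]
    positivity
  rw [h1, Real.sqrt_inv, one_div, inv_inv, ← Real.sqrt_div (by positivity)]
  calc √(s / v) * Real.exp (-r ^ 2 / (2 * v)) ≤ √(s / v) :=
        mul_le_of_le_one_right (Real.sqrt_nonneg _) h2
    _ ≤ √(2 * σ ^ 2 / v / b) := by
        refine Real.sqrt_le_sqrt ?_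
        rw [div_right_comm]
        exact div_le_div_of_nonneg_right hle hv.le

end LinBandit


theorem theorem2 {d K : ℕ} (μ₀ : EuclideanSpace ℝ (Fin d)) (S₀ : Matrix (Fin d) (Fin d) ℝ)
    (hS₀ : S₀.PosDef) (σ : ℝ) (hσ : 0 < σ)
    (x : Fin K → EuclideanSpace ℝ (Fin d)) (hx : ∀ i j, i ≠ j → x i ≠ x j)
    (hspan : Submodule.span ℝ (Set.range x) = ⊤)
    (ω : Fin K → ℝ) (hω : ∀ i, 0 < ω i) (hω_sum : ∑ i, ω i = 1) :
    (∀ n : ℕ, 1 ≤ n → (∀ i, ∃ m : ℕ, ω i * n = m) →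
      LinBandit.covPosteriorMean μ₀ S₀ x σ (LinBandit.pulls ω n) =
          LinBandit.covExplicit S₀ x σ ω n ∧
        ∀ best J, LinBandit.IsBestArm x best →
          LinBandit.IsDecisionRule μ₀ S₀ x σ (LinBandit.pulls ω n) J →
          LinBandit.expectedPoE μ₀ S₀ x σ (LinBandit.pulls ω n) best J ≤
            ∑ i, ∑ j ∈ Finset.univ.erase i,
              1 / √(1 + n * LinBandit.sqNorm
                    (LinBandit.covPosteriorMean μ₀ S₀ x σ (LinBandit.pulls ω n)) (x i - x j) /
                  LinBandit.sqNorm (LinBandit.sigmaTilde S₀ x σ ω n) (x i - x j)) *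
                Real.exp (-(inner ℝ μ₀ (x i) - inner ℝ μ₀ (x j)) ^ 2 /
                  (2 * LinBandit.sqNorm S₀ (x i - x j)))) ∧
      ∃ C : ℝ, ∀ n : ℕ, 1 ≤ n → ∀ best J, LinBandit.IsBestArm x best →
        LinBandit.IsDecisionRule μ₀ S₀ x σ (LinBandit.pulls ω n) J →
        LinBandit.expectedPoE μ₀ S₀ x σ (LinBandit.pulls ω n) best J ≤ C / √(n : ℝ) := by
  refine ⟨fun n hn hint => ⟨?_, fun best J hbest hJ => ?_⟩, ?_⟩
  · rw [LinBandit.covPosteriorMean_eq μ₀ x _ hS₀ hσ, LinBandit.pulls_eq_of_exists_nat hint,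
      LinBandit.covExplicit_eq_sub hS₀ x hσ (fun i => (hω i).le)]
  · refine (LinBandit.expectedPoE_le μ₀ x _ hS₀ hσ hx hbest hJ).trans (le_of_eq ?_)
    have hn' : (n : ℝ) ≠ 0 := by positivity
    rw [LinBandit.covPosteriorMean_eq μ₀ x _ hS₀ hσ, LinBandit.pulls_eq_of_exists_nat hint,
      LinBandit.sigmaTilde_eq_smul hS₀ x σ (fun i => (hω i).le) hn]
    simp_rw [LinBandit.sqNorm_smul, mul_div_mul_left _ _ hn']
  · have hK : Nonempty (Fin K) := by
      by_contra h
      rw [not_nonempty_iff] at h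
      simp at hω_sum
    obtain ⟨i₀, hi₀⟩ := Finite.exists_min ω
    have hκ := hω i₀
    set κ := ω i₀
    refine ⟨1 / √κ + ∑ i, ∑ j ∈ Finset.univ.erase i,
      √(2 * σ ^ 2 / LinBandit.sqNorm S₀ (x i - x j)) / √(κ / 2), fun n hn best J hbest hJ => ?_⟩
    have hn' : (0 : ℝ) < n := by positivity
    rcases lt_or_ge (κ * n) 1 with hlt | hge
    -- Fewer than `1 / κ` rounds: the trivial bound `1` is at most `1 / √(κ n)`.
    · refine (LinBandit.expectedPoE_le_one μ₀ S₀ x σ _ hbest.measurable hJ.measurable).trans ?_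
      rw [le_div_iff₀ (Real.sqrt_pos.mpr hn'), one_mul]
      have h1 : √(n : ℝ) ≤ 1 / √κ := by
        rw [le_div_iff₀ (Real.sqrt_pos.mpr hκ), ← Real.sqrt_mul hn'.le, Real.sqrt_le_iff,
          mul_comm]
        exact ⟨zero_le_one, by rw [one_pow]; exact hlt.le⟩
      have h2 : 0 ≤ ∑ i, ∑ j ∈ Finset.univ.erase i,
          √(2 * σ ^ 2 / LinBandit.sqNorm S₀ (x i - x j)) / √(κ / 2) :=
        Finset.sum_nonneg fun i _ => Finset.sum_nonneg fun j _ => by positivity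
      linarith
    -- Otherwise rounding at most halves the number of pulls.
    · have hpulls : ∀ i, κ / 2 * n ≤ (LinBandit.pulls ω n i : ℝ) := fun i => by
        have h1 : κ * n ≤ ω i * n := mul_le_mul_of_nonneg_right (hi₀ i) hn'.le
        have h2 := LinBandit.half_le_floor (hge.trans h1)
        rw [LinBandit.pulls]
        linarith
      refine (LinBandit.expectedPoE_le μ₀ x _ hS₀ hσ hx hbest hJ).trans ?_
      rw [add_div, Finset.sum_div]
      refine le_add_of_nonneg_of_le (by positivity) (Finset.sum_le_sum fun i _ => ?_)
      rw [Finset.sum_div]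
      refine Finset.sum_le_sum fun j hj => ?_
      have hij : i ≠ j := (Finset.ne_of_mem_erase hj).symm
      refine (LinBandit.pair_bound_le hS₀ x hσ (fun k => Nat.cast_nonneg _) hij (hx i j hij)
        (mul_pos (half_pos hκ) hn') (hpulls i) (hpulls j) _).trans (le_of_eq ?_)
      rw [Real.sqrt_mul (half_pos hκ).le, div_div]
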